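/- Let $\hbar,r>0$ and $\mathcal H=L^2(\mathbb R,\mathbb C)$. Let $Q$ be multiplication by the variable on its maximal domain, and $P=-i\hbar\,\mathrm d/\mathrm dx$ (weak derivative) on its maximal domain, so that both are self-adjoint. Let $$a=\frac1{\sqrt2\,r}\Bigl(Q+\frac{i r^2}{\hbar}P\Bigr),\qquad \operatorname{dom}a=\operatorname{dom}Q\cap\operatorname{dom}P,$$ let $a^\dagger$ be its adjoint, and let the number operator $a^\dagger a$ have the domain $\{\zeta\in\operatorname{dom}a: a\zeta\in\operatorname{dom}a^\dagger\}$. For $z=z'+iz''\in\mathbb C$ the displacement operator is $$D(z)=W\bigl(-\sqrt2\,r z',\ \sqrt2\,\hbar z''/r\bigr),\qquad W(q,p)=e^{ipq/2\hbar}e^{ipQ/\hbar}e^{iqP/\hbar},$$ where $(e^{ipQ/\hbar}\psi)(x)=e^{ipx/\hbar}\psi(x)$ and $(e^{iqP/\hbar}\psi)(x)=\psi(x+q)$. (a) For every $z\in\mathbb C$, $D(z)=\exp(za^\dagger-\overline z a)$; that is, $D(z)$ is the time-one operator of a strongly continuous one-parameter unitary group whose infinitesimal generator is the closure of $za^\dagger-\overline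 z a$. (b) Let $f:\mathbb M\to\mathbb C$ be a (real-)differentiable function on Minkowski space $\mathbb M=\mathbb R^4$ and let $\zeta$ be in the domain of $a^\dagger a$. Then $x\mapsto D(f(x))\zeta$ is Fréchet-differentiable on $\mathbb M$, and for all $x\in\mathbb M$ and $\mu\in\{0,1,2,3\}$ the vector $D(f(x))\zeta$ belongs to the domain of $X_\mu(x)$ and $$i\hbar\,\partial_\mu D(f(x))\zeta=X_\mu(x)D(f(x))\zeta,$$ where $\partial_\mu=\partial/\partial x^\mu$, $$\frac1\hbar X_\mu(x)=f(x)\wedge\partial_\mu f(x)+i\,\partial_\mu f(x)\,a^\dagger-i\,\partial_\mu\overline{f(x)}\,a$$ on $\operatorname{dom}a\cap\operatorname{dom}a^\dagger$, and $z_1\wedge z_2=z_1'z_2''-z_1''z_2'$. -/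

import Mathlib

open MeasureTheory
open scoped ENNReal ContDiff ComplexConjugate

noncomputable section

namespace Oscillator

/-- The Hilbert space `L²(ℝ, ℂ)` of the quantum harmonic oscillator. -/
abbrev H : Type := Lp ℂ 2 (volume : Measure ℝ)

/-- Minkowski space, with its coordinates `x⁰, x¹, x², x³`. Only its structure as a
finite-dimensional real topological vector space enters in differentiability. -/
abbrev Minkowski : Type := EuclideanSpace ℝ (Fin 4)

/-- The partial derivative `∂_μ g (x) = ∂ g / ∂ x^μ`. -/
def partialD {E : Type*} [NormedAddCommGroup E] [NormedSpace ℝ E] (μ : Fin 4)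
    (g : Minkowski → E) (x : Minkowski) : E :=
  lineDeriv ℝ g x (EuclideanSpace.single μ (1 : ℝ))

/-! ### Position and momentum -/

/-- The graph of the position operator: all pairs `(ψ, φ)` in `L² × L²` with `φ(x) = x ψ(x)`. -/
def positionGraph : Submodule ℂ (H × H) where
  carrier := {w | ∀ᵐ x : ℝ, w.2 x = (x : ℂ) * w.1 x}
  zero_mem' := by
    filter_upwards [Lp.coeFn_zero ℂ 2 (volume : Measure ℝ)] with x hx
    simp
  add_mem' := by
    intro v w hv hw
    filter_upwards [hv, hw, Lp.coeFn_add v.1 w.1, Lp.coeFn_add v.2 w.2] with x h1 h2 h3 h4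
    simp only [Prod.fst_add, Prod.snd_add, h3, h4, Pi.add_apply, h1, h2]
    ring
  smul_mem' := by
    intro c v hv
    filter_upwards [hv, Lp.coeFn_smul c v.1, Lp.coeFn_smul c v.2] with x h1 h3 h4
    simp only [Prod.smul_fst, Prod.smul_snd, h3, h4, Pi.smul_apply, h1, smul_eq_mul]
    ring

/-- The position operator `Q`, multiplication by `x` on its maximal domain. -/
def Q : H →ₗ.[ℂ] H := positionGraph.toLinearPMap

theorem positionGraph_functional (w : H × H) (hw : w ∈ positionGraph) (h0 : w.1 = 0) :
    w.2 = 0 := by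
  have hw' : ∀ᵐ x : ℝ, w.2 x = (x : ℂ) * w.1 x := hw
  rw [h0] at hw'
  apply Lp.ext
  filter_upwards [hw', Lp.coeFn_zero ℂ 2 (volume : Measure ℝ)] with x h1 h2
  rw [h1, h2]
  simp

theorem graph_Q : Q.graph = positionGraph :=
  Submodule.toLinearPMap_graph_eq _ positionGraph_functional

theorem integrable_test_smul {g : ℝ → ℝ} (hg : Continuous g) (hs : HasCompactSupport g) (ψ : H) :
    Integrable (fun x => g x • ψ x) :=
  ((Lp.memLp ψ).locallyIntegrable (by norm_num)).integrable_smul_left_of_hasCompactSupport hg hs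

theorem integrable_test_deriv_smul {g : ℝ → ℝ} (hg : ContDiff ℝ ∞ g) (hs : HasCompactSupport g)
    (ψ : H) : Integrable (fun x => deriv g x • ψ x) :=
  integrable_test_smul (hg.continuous_deriv (by simp)) hs.deriv ψ

/-- The graph of the momentum operator: all pairs `(ψ, φ)` in `L² × L²` such that
`φ = -iħ ψ'` in the sense of weak derivatives, i.e. `∫ g φ = iħ ∫ g' ψ` for all test functions
`g`. This is the graph of the self-adjoint extension of `-iħ d/dx`. -/
def momentumGraph (ħ : ℝ) : Submodule ℂ (H × H) where
  carrier := {w | ∀ g : ℝ → ℝ, ContDiff ℝ ∞ g → HasCompactSupport g →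
    ∫ x, g x • w.2 x = (Complex.I * (ħ : ℂ)) * ∫ x, deriv g x • w.1 x}
  zero_mem' := by
    intro g _ _
    have h0 := Lp.coeFn_zero ℂ 2 (volume : Measure ℝ)
    have h1 : ∫ x, g x • (0 : H) x = 0 :=
      integral_eq_zero_of_ae (by filter_upwards [h0] with x hx; simp)
    have h2 : ∫ x, deriv g x • (0 : H) x = 0 :=
      integral_eq_zero_of_ae (by filter_upwards [h0] with x hx; simp)
    simp only [Prod.fst_zero, Prod.snd_zero, h1, h2, mul_zero]
  add_mem' := by
    intro v w hv hw g hg hs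
    have h1 : ∫ x, g x • (v + w).2 x = (∫ x, g x • v.2 x) + ∫ x, g x • w.2 x := by
      rw [← integral_add (integrable_test_smul hg.continuous hs v.2)
        (integrable_test_smul hg.continuous hs w.2)]
      apply integral_congr_ae
      filter_upwards [Lp.coeFn_add v.2 w.2] with x hx
      rw [Prod.snd_add, hx, Pi.add_apply, smul_add]
    have h2 : ∫ x, deriv g x • (v + w).1 x
        = (∫ x, deriv g x • v.1 x) + ∫ x, deriv g x • w.1 x := by
      rw [← integral_add (integrable_test_deriv_smul hg hs v.1)
        (integrable_test_deriv_smul hg hs w.1)]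
      apply integral_congr_ae
      filter_upwards [Lp.coeFn_add v.1 w.1] with x hx
      rw [Prod.fst_add, hx, Pi.add_apply, smul_add]
    rw [h1, h2, hv g hg hs, hw g hg hs, mul_add]
  smul_mem' := by
    intro c v hv g hg hs
    have h1 : ∫ x, g x • (c • v).2 x = c * ∫ x, g x • v.2 x := by
      rw [← integral_const_mul]
      apply integral_congr_ae
      filter_upwards [Lp.coeFn_smul c v.2] with x hx
      rw [Prod.smul_snd, hx, Pi.smul_apply, smul_comm, smul_eq_mul]
    have h2 : ∫ x, deriv g x • (c • v).1 x = c * ∫ x, deriv g x • v.1 x := by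
      rw [← integral_const_mul]
      apply integral_congr_ae
      filter_upwards [Lp.coeFn_smul c v.1] with x hx
      rw [Prod.smul_fst, hx, Pi.smul_apply, smul_comm, smul_eq_mul]
    rw [h1, h2, hv g hg hs]
    ring

/-- The momentum operator `P`, the self-adjoint extension of `-iħ d/dx`. -/
def P (ħ : ℝ) : H →ₗ.[ℂ] H := (momentumGraph ħ).toLinearPMap

theorem momentumGraph_functional (ħ : ℝ) (w : H × H) (hw : w ∈ momentumGraph ħ) (h0 : w.1 = 0) :
    w.2 = 0 := by
  have key := ae_eq_zero_of_integral_contDiff_smul_eq_zero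
    ((Lp.memLp w.2).locallyIntegrable (by norm_num)) (fun g hg hs => by
      have h := hw g hg hs
      have h2 : ∫ x, deriv g x • w.1 x = 0 := by
        rw [h0]
        refine integral_eq_zero_of_ae ?_
        filter_upwards [Lp.coeFn_zero ℂ 2 (volume : Measure ℝ)] with x hx
        simp
      rw [h, h2, mul_zero])
  apply Lp.ext
  filter_upwards [key, Lp.coeFn_zero ℂ 2 (volume : Measure ℝ)] with x h1 h2
  rw [h1, h2]
  rfl

theorem graph_P (ħ : ℝ) : (P ħ).graph = momentumGraph ħ :=
  Submodule.toLinearPMap_graph_eq _ (momentumGraph_functional ħ)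

/-! ### Annihilation, creation and number operators -/

/-- The annihilation operator `a = (Q + i (r²/ħ) P) / (√2 r)` with domain `dom Q ∩ dom P`
(on which it is closed), normalised such that `[a, a†] = 1`. -/
def annihilation (ħ r : ℝ) : H →ₗ.[ℂ] H :=
  ((1 / (√2 * r) : ℝ) : ℂ) • (Q + (Complex.I * ((r ^ 2 / ħ : ℝ) : ℂ)) • P ħ)

/-- The creation operator `a†`, the Hilbert space adjoint of `a`. -/
def creation (ħ r : ℝ) : H →ₗ.[ℂ] H := (annihilation ħ r).adjoint

/-- The domain of the number operator `a† a`. -/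
def numberDomain (ħ r : ℝ) : Set H :=
  {ζ | ∃ h : ζ ∈ (annihilation ħ r).domain,
    annihilation ħ r ⟨ζ, h⟩ ∈ (creation ħ r).domain}

/-! ### Weyl operators and displacement operators -/

theorem memLp_phase_mul (s : ℝ) (ψ : H) :
    MemLp (fun x : ℝ => Complex.exp (Complex.I * ((s * x : ℝ) : ℂ)) * ψ x) 2 volume := by
  refine (Lp.memLp ψ).of_le (g := ψ) ?_ ?_
  · exact (Continuous.aestronglyMeasurable (by fun_prop)).mul (Lp.aestronglyMeasurable ψ)
  · refine Filter.Eventually.of_forall fun x => ?_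
    rw [norm_mul, mul_comm Complex.I, Complex.norm_exp_ofReal_mul_I, one_mul]

/-- The unitary operator `e^{isQ}`, multiplication by `e^{isx}`. -/
def expQ (s : ℝ) : H →ₗᵢ[ℂ] H where
  toFun ψ := (memLp_phase_mul s ψ).toLp _
  map_add' ψ φ := by
    apply Lp.ext
    filter_upwards [(memLp_phase_mul s (ψ + φ)).coeFn_toLp, (memLp_phase_mul s ψ).coeFn_toLp,
      (memLp_phase_mul s φ).coeFn_toLp, Lp.coeFn_add ψ φ,
      Lp.coeFn_add ((memLp_phase_mul s ψ).toLp _) ((memLp_phase_mul s φ).toLp _)]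
      with x h1 h2 h3 h4 h5
    rw [h1, h5, Pi.add_apply, h2, h3, h4, Pi.add_apply, mul_add]
  map_smul' c ψ := by
    apply Lp.ext
    filter_upwards [(memLp_phase_mul s (c • ψ)).coeFn_toLp, (memLp_phase_mul s ψ).coeFn_toLp,
      Lp.coeFn_smul c ψ, Lp.coeFn_smul c ((memLp_phase_mul s ψ).toLp _)]
      with x h1 h2 h3 h4
    simp only [RingHom.id_apply]
    rw [h1, h4, Pi.smul_apply, h2, h3, Pi.smul_apply, smul_eq_mul, smul_eq_mul]
    ring
  norm_map' ψ := by
    change ‖(memLp_phase_mul s ψ).toLp _‖ = ‖ψ‖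
    rw [Lp.norm_toLp, Lp.norm_def]
    congr 1
    refine eLpNorm_congr_norm_ae (Filter.Eventually.of_forall fun x => ?_)
    rw [norm_mul, mul_comm Complex.I, Complex.norm_exp_ofReal_mul_I, one_mul]

/-- The unitary operator `e^{iqP/ħ}`, the translation `ψ ↦ ψ(· + q)`. -/
def expP (q : ℝ) : H →ₗᵢ[ℂ] H :=
  Lp.compMeasurePreservingₗᵢ ℂ (fun x : ℝ => x + q) (measurePreserving_add_right volume q)

/-- The Weyl operator `W(q,p) = e^{ipq/2ħ} e^{ipQ/ħ} e^{iqP/ħ}`. -/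
def weyl (ħ q p : ℝ) : H →L[ℂ] H :=
  Complex.exp (Complex.I * ((p * q / (2 * ħ) : ℝ) : ℂ)) •
    ((expQ (p / ħ)).toContinuousLinearMap.comp (expP q).toContinuousLinearMap)

/-- The displacement operator `D(z) = W(-√2 r z', √2 ħ z''/r)`, `z = z' + i z''`. -/
def displacement (ħ r : ℝ) (z : ℂ) : H →L[ℂ] H :=
  weyl ħ (-(√2 * r * z.re)) (√2 * ħ * z.im / r)

/-- `IsUnitaryExp A V` says that `V = exp(A)` in the sense of Stone's theorem: there is a strongly
continuous one-parameter group of unitary operators `U t = exp(t A)`, `U 1 = V`, whose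
infinitesimal generator (with its exact domain) is the closure of `A`. -/
def IsUnitaryExp (A : H →ₗ.[ℂ] H) (V : H →L[ℂ] H) : Prop :=
  ∃ U : ℝ → H →L[ℂ] H,
    (∀ t, U t ∈ unitary (H →L[ℂ] H)) ∧
    U 0 = 1 ∧
    (∀ s t, U (s + t) = U s * U t) ∧
    (∀ ψ : H, Continuous fun t => U t ψ) ∧
    (∀ ψ φ : H, HasDerivAt (fun t => U t ψ) φ 0 ↔ (ψ, φ) ∈ A.graph.topologicalClosure) ∧
    U 1 = V

/-! ### The operators `X_μ(x)` -/

/-- `z₁ ∧ z₂ = z₁' z₂'' - z₁'' z₂'`. -/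
def wedge (z₁ z₂ : ℂ) : ℝ := z₁.re * z₂.im - z₁.im * z₂.re

/-- `X_μ(x) = ħ (f(x) ∧ ∂_μ f(x) + i ∂_μ f(x) a† - i ∂_μ f̄(x) a)`. -/
def X (ħ r : ℝ) (f : Minkowski → ℂ) (μ : Fin 4) (x : Minkowski) : H →ₗ.[ℂ] H :=
  (ħ : ℂ) • (((wedge (f x) (partialD μ f x) : ℝ) : ℂ) • (LinearMap.id : H →ₗ[ℂ] H).toPMap ⊤
    + (Complex.I * partialD μ f x) • creation ħ r
    - (Complex.I * partialD μ (fun y => conj (f y)) x) • annihilation ħ r)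

end Oscillator

end

namespace Oscillator

open Filter Topology

/-! ### The one-parameter groups `expQ` and `expP` -/

/-! Everything rests on the composition law `D(w) D(z) = exp(i z∧w) D(z+w)`
(`displacement_displacement`), a consequence of the Weyl relation `expP_expQ`. Since `tz ∧ sz = 0`,
the operators `D(tz)` form a one-parameter unitary group.

On `dom Q ∩ dom P` both factors of `D` can be differentiated: the maximal graphs of `Q` and `P` are
tied to the derivatives of `e^{isQ}` and `e^{iqP/ħ}` by `hasDerivAt_expQ_of_mem` and
`mem_momentumGraph_iff`. By symmetry of `Q` and `P`, this space lies in `dom a†`, and the real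
Fréchet derivative of `D` at `0` is `u ↦ u a† - ū a`. The space is dense and invariant under every
`D(z)`, hence a core for the generator of `t ↦ D(tz)` (`hasDerivAt_iff_mem_closure`); this is (a).

For (b), `D(z+u) = exp(-i z∧u) D(u) D(z)` carries the derivative from `0` to `z`. Because `D(z)ψ`
stays in `dom a`, the result is `u ↦ (u a† - ū a - i z∧u) D(z)ψ` (`hasFDerivAt_displacement`). The
chain rule with `f` and the factor `iħ` give `X_μ`. -/

theorem coeFn_expQ (s : ℝ) (ψ : H) :
    expQ s ψ =ᵐ[volume] fun x : ℝ => Complex.exp (Complex.I * ((s * x : ℝ) : ℂ)) * ψ x :=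
  (memLp_phase_mul s ψ).coeFn_toLp

theorem coeFn_expP (q : ℝ) (ψ : H) : expP q ψ =ᵐ[volume] fun x : ℝ => ψ (x + q) :=
  Lp.coeFn_compMeasurePreserving ψ (measurePreserving_add_right volume q)

theorem expQ_add (s t : ℝ) (ψ : H) : expQ (s + t) ψ = expQ s (expQ t ψ) := by
  apply Lp.ext
  filter_upwards [coeFn_expQ (s + t) ψ, coeFn_expQ s (expQ t ψ), coeFn_expQ t ψ] with x h1 h2 h3
  rw [h1, h2, h3, ← mul_assoc, ← Complex.exp_add]
  congr 2
  push_cast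
  ring

theorem expQ_zero (ψ : H) : expQ 0 ψ = ψ := by
  apply Lp.ext
  filter_upwards [coeFn_expQ 0 ψ] with x h1
  simp [h1]

theorem expP_add (s t : ℝ) (ψ : H) : expP (s + t) ψ = expP s (expP t ψ) := by
  apply Lp.ext
  have h3 := (measurePreserving_add_right volume s).quasiMeasurePreserving.ae_eq_comp
    (coeFn_expP t ψ)
  filter_upwards [coeFn_expP (s + t) ψ, coeFn_expP s (expP t ψ), h3] with x h1 h2 h3
  simp only [Function.comp_apply] at h3
  rw [h1, h2, h3, add_assoc]

theorem expP_zero (ψ : H) : expP 0 ψ = ψ := by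
  apply Lp.ext
  filter_upwards [coeFn_expP 0 ψ] with x h1
  simp [h1]

/-- The Weyl form of the canonical commutation relations. -/
theorem expP_expQ (q s : ℝ) (ψ : H) :
    expP q (expQ s ψ) = Complex.exp (Complex.I * ((s * q : ℝ) : ℂ)) • expQ s (expP q ψ) := by
  apply Lp.ext
  have h3 := (measurePreserving_add_right volume q).quasiMeasurePreserving.ae_eq_comp
    (coeFn_expQ s ψ)
  filter_upwards [coeFn_expP q (expQ s ψ), coeFn_expQ s (expP q ψ), h3, coeFn_expP q ψ,
    Lp.coeFn_smul (Complex.exp (Complex.I * ((s * q : ℝ) : ℂ))) (expQ s (expP q ψ))]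
    with x h1 h2 h3 h4 h5
  simp only [Function.comp_apply] at h3
  rw [h1, h5, Pi.smul_apply, h2, h3, h4, smul_eq_mul, ← mul_assoc, ← Complex.exp_add]
  congr 2
  push_cast
  ring

theorem continuous_expP (ψ : H) : Continuous fun q => expP q ψ := by
  have hc : Continuous fun q : ℝ => (⟨fun x : ℝ => x + q, by fun_prop⟩ : C(ℝ, ℝ)) :=
    ContinuousMap.continuous_of_continuous_uncurry _ (by
      change Continuous fun p : ℝ × ℝ => p.2 + p.1
      fun_prop)
  exact (continuous_const (y := ψ)).compMeasurePreservingLp hc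
    (fun q => measurePreserving_add_right volume q) (by norm_num)

theorem norm_sq_eq_integral (ψ : H) : ‖ψ‖ ^ 2 = ∫ x, ‖ψ x‖ ^ 2 := by
  have h : inner ℂ ψ ψ = ((‖ψ‖ : ℝ) : ℂ) ^ 2 := inner_self_eq_norm_sq_to_K ψ
  rw [L2.inner_def] at h
  have h2 : ∀ x, inner ℂ (ψ x) (ψ x) = ((‖ψ x‖ ^ 2 : ℝ) : ℂ) := fun x => by
    rw [inner_self_eq_norm_sq_to_K]
    simp
  simp only [h2] at h
  rw [integral_complex_ofReal] at h
  exact_mod_cast h.symm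

/-- Dominated convergence for the squared norms. The explicit representatives `G t` carry the
pointwise estimates, because the null set on which `F t` differs from `G t` may vary with `t`. -/
theorem tendsto_zero_of_dominated {ι : Type*} {l : Filter ι} [l.IsCountablyGenerated]
    {F : ι → H} {G : ι → ℝ → ℂ} (g : H) (hFG : ∀ t, F t =ᵐ[volume] G t)
    (hb : ∀ᶠ t in l, ∀ᵐ x : ℝ, ‖G t x‖ ≤ ‖g x‖)
    (hlim : ∀ᵐ x : ℝ, Tendsto (fun t => G t x) l (𝓝 0)) : Tendsto F l (𝓝 0) := by
  have h : Tendsto (fun t => ∫ x, ‖F t x‖ ^ 2) l (𝓝 (∫ _ : ℝ, (0 : ℝ))) := by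
    have hc : (fun t => ∫ x, ‖F t x‖ ^ 2) = fun t => ∫ x, ‖G t x‖ ^ 2 := by
      funext t
      apply integral_congr_ae
      filter_upwards [hFG t] with x hx
      rw [hx]
    rw [hc]
    refine tendsto_integral_filter_of_dominated_convergence (fun x => ‖g x‖ ^ 2) ?_ ?_ ?_ ?_
    · refine Eventually.of_forall fun t => ?_
      exact (((Lp.aestronglyMeasurable (F t)).congr (hFG t)).norm).pow 2
    · filter_upwards [hb] with t ht
      filter_upwards [ht] with x hx
      rw [norm_pow, norm_norm]
      gcongr
    · exact (Lp.memLp g).integrable_norm_pow (by norm_num)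
    · filter_upwards [hlim] with x hx
      simpa using hx.norm.pow 2
  rw [integral_zero] at h
  simp only [← norm_sq_eq_integral] at h
  have h2 := h.sqrt
  simp only [Real.sqrt_sq (norm_nonneg _), Real.sqrt_zero] at h2
  exact tendsto_zero_iff_norm_tendsto_zero.mpr h2

theorem continuousAt_expQ_zero (ψ : H) : ContinuousAt (fun s => expQ s ψ) 0 := by
  rw [ContinuousAt, expQ_zero, ← tendsto_sub_nhds_zero_iff]
  refine tendsto_zero_of_dominated ((2 : ℂ) • ψ)
    (G := fun s x => Complex.exp (Complex.I * ((s * x : ℝ) : ℂ)) * ψ x - ψ x) ?_ ?_ ?_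
  · intro s
    filter_upwards [coeFn_expQ s ψ, Lp.coeFn_sub (expQ s ψ) ψ] with x h1 h2
    rw [h2, Pi.sub_apply, h1]
  · refine Eventually.of_forall fun s => ?_
    filter_upwards [Lp.coeFn_smul (2 : ℂ) ψ] with x hx
    rw [hx]
    refine (norm_sub_le _ _).trans ?_
    rw [norm_mul, mul_comm Complex.I, Complex.norm_exp_ofReal_mul_I, one_mul, Pi.smul_apply,
      norm_smul, Complex.norm_ofNat]
    linarith
  · refine Eventually.of_forall fun x => ?_
    have : Continuous fun s : ℝ => Complex.exp (Complex.I * ((s * x : ℝ) : ℂ)) * ψ x - ψ x := by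
      fun_prop
    simpa using this.tendsto 0

theorem continuous_expQ (ψ : H) : Continuous fun s => expQ s ψ := by
  rw [continuous_iff_continuousAt]
  intro s
  have h := (continuousAt_expQ_zero (expQ s ψ))
  have h2 : ContinuousAt (fun t : ℝ => expQ (t - s) (expQ s ψ)) s :=
    ContinuousAt.comp (f := fun t : ℝ => t - s) (g := fun t => expQ t (expQ s ψ))
      (by simpa using h) (by fun_prop)
  refine h2.congr (Eventually.of_forall fun t => ?_)
  simp only [← expQ_add, sub_add_cancel]

theorem hasDerivAt_expQ_of_mem {ψ φ : H} (h : (ψ, φ) ∈ positionGraph) :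
    HasDerivAt (fun s => expQ s ψ) (Complex.I • φ) 0 := by
  have h : ∀ᵐ x : ℝ, φ x = (x : ℂ) * ψ x := h
  rw [hasDerivAt_iff_tendsto_slope_zero, ← tendsto_sub_nhds_zero_iff]
  simp only [zero_add, expQ_zero]
  -- By `|e^{isx} - 1| ≤ |sx|` the difference quotient is at most `|xψ| = |φ|`; the subtracted limit
  -- contributes another `|φ|`, whence the factor 2.
  refine tendsto_zero_of_dominated ((2 : ℂ) • φ)
    (G := fun s x => s⁻¹ • (Complex.exp (Complex.I * ((s * x : ℝ) : ℂ)) * ψ x - ψ x)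
      - Complex.I * (x * ψ x)) ?_ ?_ ?_
  · intro s
    filter_upwards [coeFn_expQ s ψ, Lp.coeFn_sub (expQ s ψ) ψ,
      Lp.coeFn_sub (s⁻¹ • (expQ s ψ - ψ)) (Complex.I • φ), Lp.coeFn_smul s⁻¹ (expQ s ψ - ψ),
      Lp.coeFn_smul Complex.I φ, h] with x h1 h2 h3 h4 h5 h6
    rw [h3, Pi.sub_apply, h4, h5, Pi.smul_apply, Pi.smul_apply, h2, Pi.sub_apply, h1, h6,
      smul_eq_mul]
  · filter_upwards [self_mem_nhdsWithin] with s hs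
    have hs : s ≠ 0 := hs
    filter_upwards [Lp.coeFn_smul (2 : ℂ) φ, h] with x hx h6
    rw [hx, Pi.smul_apply, norm_smul, h6, Complex.norm_ofNat]
    refine (norm_sub_le _ _).trans ?_
    have h7 := Real.norm_exp_I_mul_ofReal_sub_one_le (x := s * x)
    have h8 : ‖s⁻¹ • (Complex.exp (Complex.I * ((s * x : ℝ) : ℂ)) * ψ x - ψ x)‖
        ≤ ‖(x : ℂ) * ψ x‖ := by
      rw [norm_smul, ← sub_one_mul, norm_mul, norm_mul, norm_inv, Complex.norm_real,
        inv_mul_le_iff₀ (norm_pos_iff.mpr hs), ← mul_assoc]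
      rw [norm_mul] at h7
      gcongr
    rw [norm_mul Complex.I, Complex.norm_I]
    linarith
  · refine Eventually.of_forall fun x => ?_
    have h1 : HasDerivAt (fun s : ℝ => Complex.exp (Complex.I * ((s * x : ℝ) : ℂ)) * ψ x)
        (Complex.I * (x * ψ x)) 0 := by
      have h2 : HasDerivAt (fun s : ℝ => Complex.I * ((s * x : ℝ) : ℂ)) (Complex.I * x) 0 := by
        have h3 : HasDerivAt (fun s : ℝ => s * x) x 0 := by
          simpa using (hasDerivAt_id (0 : ℝ)).mul_const x
        exact h3.ofReal_comp.const_mul _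
      have h4 := h2.cexp.mul_const (ψ x)
      simpa [mul_assoc] using h4
    have h2 := hasDerivAt_iff_tendsto_slope_zero.mp h1
    rw [← tendsto_sub_nhds_zero_iff] at h2
    simpa using h2

/-! ### Test functions and the momentum operator -/

theorem memLp_test {g : ℝ → ℝ} (hg : Continuous g) (hs : HasCompactSupport g) :
    MemLp (fun x => (g x : ℂ)) 2 (volume : Measure ℝ) :=
  (Complex.continuous_ofReal.comp hg).memLp_of_hasCompactSupport (hs.comp_left Complex.ofReal_zero)

theorem inner_test {g : ℝ → ℝ} (hg : Continuous g) (hs : HasCompactSupport g) (ψ : H) :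
    inner ℂ ((memLp_test hg hs).toLp _) ψ = ∫ x, g x • ψ x := by
  rw [L2.inner_def]
  apply integral_congr_ae
  filter_upwards [(memLp_test hg hs).coeFn_toLp] with x hx
  rw [hx, RCLike.inner_apply, Complex.conj_ofReal, mul_comm, Complex.real_smul]

theorem eq_zero_of_integral_test_eq_zero {ψ : H}
    (h : ∀ g : ℝ → ℝ, ContDiff ℝ ∞ g → HasCompactSupport g → ∫ x, g x • ψ x = 0) : ψ = 0 := by
  have key := ae_eq_zero_of_integral_contDiff_smul_eq_zero
    ((Lp.memLp ψ).locallyIntegrable (by norm_num)) h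
  apply Lp.ext
  filter_upwards [key, Lp.coeFn_zero ℂ 2 (volume : Measure ℝ)] with x h1 h2
  rw [h1, h2]
  rfl

theorem integral_test_expP (g : ℝ → ℝ) (t : ℝ) (ψ : H) :
    ∫ x, g x • expP t ψ x = ∫ x, g x • ψ (x + t) := by
  apply integral_congr_ae
  filter_upwards [coeFn_expP t ψ] with x hx
  rw [hx]

/-- The pairing is the convolution of `g(-·)` with `ψ`, so the derivative in `t` falls on the smooth
factor and nothing is required of `ψ`. -/
theorem hasDerivAt_integral_test_expP {g : ℝ → ℝ} (hg : ContDiff ℝ ∞ g)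
    (hs : HasCompactSupport g) (ψ : H) (t : ℝ) :
    HasDerivAt (fun t => ∫ x, g x • expP t ψ x) (-∫ x, deriv g x • expP t ψ x) t := by
  have hs' : HasCompactSupport fun x => g (-x) :=
    hs.comp_homeomorph (Homeomorph.neg ℝ)
  have hg' : ContDiff ℝ 1 fun x => g (-x) := (hg.of_le (by simp)).comp contDiff_neg
  have h := hs'.hasDerivAt_convolution_left (ContinuousLinearMap.lsmul ℝ ℝ) (μ := volume) hg'
    ((Lp.memLp ψ).locallyIntegrable (by norm_num)) t
  have he : (fun t => ∫ x, g x • expP t ψ x)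
      = convolution (fun x => g (-x)) ψ (ContinuousLinearMap.lsmul ℝ ℝ) volume := by
    funext t
    rw [integral_test_expP, convolution_def, ← integral_neg_eq_self]
    simp [sub_eq_add_neg, add_comm]
  rw [he]
  refine h.congr_deriv ?_
  rw [integral_test_expP, convolution_def, ← integral_neg_eq_self, ← integral_neg]
  refine integral_congr_ae (Eventually.of_forall fun x => ?_)
  simp [deriv_comp_neg, sub_eq_add_neg, add_comm]

theorem expP_mem_momentumGraph {ħ : ℝ} {ψ φ : H} (h : (ψ, φ) ∈ momentumGraph ħ) (t : ℝ) :
    (expP t ψ, expP t φ) ∈ momentumGraph ħ := by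
  intro g hg hs
  have key : ∀ (k : ℝ → ℝ) (χ : H), ∫ x, k x • expP t χ x = ∫ x, k (x - t) • χ x := by
    intro k χ
    rw [integral_test_expP, ← integral_add_right_eq_self (fun x => k (x - t) • χ x) t]
    simp
  have h2 := h (fun x => g (x - t)) (hg.comp (contDiff_id.sub contDiff_const))
    (hs.comp_homeomorph (Homeomorph.subRight t))
  simp only [deriv_comp_sub_const] at h2
  simp only [key]
  exact h2

/-- The weak derivative is the generator of translations. Given a weak derivative, `expP t ψ` equals
`ψ` plus the integral of the translates of `(i/ħ)φ`, since both sides have the same pairings with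
test functions; the integral is then differentiated in norm. Conversely, a norm derivative can be
paired with test functions. -/
theorem mem_momentumGraph_iff {ħ : ℝ} (hħ : ħ ≠ 0) {ψ φ : H} :
    (ψ, φ) ∈ momentumGraph ħ ↔
      HasDerivAt (fun t => expP t ψ) ((Complex.I / ħ) • φ) 0 := by
  have hħ' : (ħ : ℂ) ≠ 0 := by exact_mod_cast hħ
  have hI : Complex.I / ħ * (Complex.I * ħ) = -1 := by
    field_simp
    exact Complex.I_sq
  constructor
  · intro h
    set χ : H := (Complex.I / ħ) • φ with hχ
    have hc : Continuous fun s => expP s χ := continuous_expP χ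
    have hd : ∀ t, HasDerivAt (fun t => ∫ s in (0 : ℝ)..t, expP s χ) (expP t χ) t := fun t =>
      intervalIntegral.integral_hasDerivAt_right (hc.intervalIntegrable _ _)
        hc.aestronglyMeasurable.stronglyMeasurableAtFilter hc.continuousAt
    have hF : ∀ t, expP t ψ = ψ + ∫ s in (0 : ℝ)..t, expP s χ := by
      intro t
      rw [← sub_eq_zero]
      apply eq_zero_of_integral_test_eq_zero
      intro g hg hs
      rw [← inner_test hg.continuous hs]
      have hG : ∀ u, HasDerivAt (fun u => inner ℂ ((memLp_test hg.continuous hs).toLp _)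
          (expP u ψ - (ψ + ∫ s in (0 : ℝ)..u, expP s χ))) 0 u := by
        intro u
        simp only [inner_sub_right, inner_add_right]
        have h1 := hasDerivAt_integral_test_expP hg hs ψ u
        simp only [← inner_test hg.continuous hs] at h1
        have h2 := ((innerSL ℂ ((memLp_test hg.continuous hs).toLp _)).restrictScalars
          ℝ).hasFDerivAt.comp_hasDerivAt u (hd u)
        have h3 := h1.sub (h2.const_add (inner ℂ ((memLp_test hg.continuous hs).toLp _) ψ))
        refine h3.congr_deriv ?_
        have h4 := expP_mem_momentumGraph h u g hg hs
        simp only [] at h4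
        rw [← inner_test hg.continuous hs] at h4
        simp only [ContinuousLinearMap.coe_restrictScalars', innerSL_apply_apply, hχ, map_smul,
          h4, smul_eq_mul]
        rw [← mul_assoc, hI]
        ring
      have h5 := is_const_of_deriv_eq_zero (fun u => (hG u).differentiableAt)
        (fun u => (hG u).deriv) t 0
      rw [h5]
      simp [expP_zero]
    have h6 := (hd 0).const_add ψ
    simp only [← hF, expP_zero] at h6
    exact h6
  · intro h g hg hs
    have h1 := hasDerivAt_integral_test_expP hg hs ψ 0
    simp only [← inner_test hg.continuous hs, expP_zero] at h1
    have h2 := ((innerSL ℂ ((memLp_test hg.continuous hs).toLp _)).restrictScalars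
          ℝ).hasFDerivAt.comp_hasDerivAt 0 h
    have h3 := h1.unique h2
    simp only [ContinuousLinearMap.coe_restrictScalars', innerSL_apply_apply,
      inner_smul_right] at h3
    rw [inner_test hg.continuous hs] at h3
    simp only []
    have h4 : Complex.I * ħ * (∫ x, deriv g x • ψ x)
        = - (Complex.I * ħ * (-∫ x, deriv g x • ψ x)) := by ring
    rw [h4, h3]
    linear_combination (∫ x, g x • φ x) * hI

/-! ### Action of the Weyl factors on the graphs of `Q` and `P` -/

/-- The extra term `ħs` is the derivative of the phase `e^{isq}` in the Weyl relation; passing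
through the generator avoids a Leibniz rule for weak derivatives. -/
theorem expQ_mem_momentumGraph {ħ : ℝ} (hħ : ħ ≠ 0) {ψ φ : H} (h : (ψ, φ) ∈ momentumGraph ħ)
    (s : ℝ) : (expQ s ψ, expQ s φ + ((ħ * s : ℝ) : ℂ) • expQ s ψ) ∈ momentumGraph ħ := by
  have hħ' : (ħ : ℂ) ≠ 0 := by exact_mod_cast hħ
  rw [mem_momentumGraph_iff hħ] at h ⊢
  simp only [expP_expQ]
  have h1 := ((expQ s).toContinuousLinearMap.restrictScalars ℝ).hasFDerivAt.comp_hasDerivAt 0 h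
  have h2 : HasDerivAt (fun q : ℝ => Complex.exp (Complex.I * ((s * q : ℝ) : ℂ)))
      (Complex.I * s) 0 := by
    have h3 : HasDerivAt (fun q : ℝ => s * q) s 0 := by
      simpa using (hasDerivAt_id (0 : ℝ)).const_mul s
    simpa using (h3.ofReal_comp.const_mul Complex.I).cexp
  have h4 := h2.smul h1
  have hI : Complex.I * (s : ℂ) = Complex.I / ħ * ((ħ * s : ℝ) : ℂ) := by
    push_cast
    field_simp
  refine h4.congr_deriv ?_
  simp only [Function.comp_apply, ContinuousLinearMap.coe_restrictScalars',
    LinearIsometry.coe_toContinuousLinearMap, expP_zero, map_smul, mul_zero, Complex.ofReal_zero,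
    Complex.exp_zero, one_mul, smul_add, smul_smul]
  rw [hI]

theorem expQ_mem_positionGraph {ψ φ : H} (h : (ψ, φ) ∈ positionGraph) (s : ℝ) :
    (expQ s ψ, expQ s φ) ∈ positionGraph := by
  have h : ∀ᵐ x : ℝ, φ x = (x : ℂ) * ψ x := h
  change ∀ᵐ x : ℝ, expQ s φ x = (x : ℂ) * expQ s ψ x
  filter_upwards [h, coeFn_expQ s ψ, coeFn_expQ s φ] with x h1 h2 h3
  rw [h2, h3, h1]
  ring

theorem expP_mem_positionGraph {ψ φ : H} (h : (ψ, φ) ∈ positionGraph) (q : ℝ) :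
    (expP q ψ, expP q φ - (q : ℂ) • expP q ψ) ∈ positionGraph := by
  have h : ∀ᵐ x : ℝ, φ x = (x : ℂ) * ψ x := h
  change ∀ᵐ x : ℝ, (expP q φ - (q : ℂ) • expP q ψ : H) x = (x : ℂ) * expP q ψ x
  have h' := (measurePreserving_add_right volume q).quasiMeasurePreserving.ae h
  filter_upwards [h', coeFn_expP q ψ, coeFn_expP q φ, Lp.coeFn_sub (expP q φ) ((q : ℂ) • expP q ψ),
    Lp.coeFn_smul (q : ℂ) (expP q ψ)] with x h1 h2 h3 h4 h5
  rw [h4, Pi.sub_apply, h5, Pi.smul_apply, h2, h3, h1, smul_eq_mul]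
  push_cast
  ring

/-! ### Symmetry of `Q` and `P`; test functions in their domains -/

/-- Differentiating the constant `⟪V t ψ, V t φ⟫` shows that generators of isometries are
skew-symmetric; removing the factor `i` yields the symmetry of `Q` and `P`. -/
theorem inner_eq_of_hasDerivAt {V : ℝ → H →ₗᵢ[ℂ] H} (hV : ∀ ψ, V 0 ψ = ψ) {ψ φ ψ' φ' : H}
    (h : HasDerivAt (fun t => V t ψ) ψ' 0) (h' : HasDerivAt (fun t => V t φ) φ' 0) :
    inner ℂ ψ φ' + inner ℂ ψ' φ = 0 := by
  have h1 := HasDerivAt.inner ℂ h h'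
  simp only [LinearIsometry.inner_map_map, hV] at h1
  exact h1.unique (hasDerivAt_const _ _)

theorem inner_position_eq {ψ ψ' φ φ' : H} (h : (ψ, ψ') ∈ positionGraph)
    (h' : (φ, φ') ∈ positionGraph) : inner ℂ ψ' φ = inner ℂ ψ φ' := by
  have h1 := inner_eq_of_hasDerivAt expQ_zero (hasDerivAt_expQ_of_mem h) (hasDerivAt_expQ_of_mem h')
  rw [inner_smul_left, inner_smul_right, Complex.conj_I, neg_mul, add_neg_eq_zero] at h1
  exact (mul_left_cancel₀ Complex.I_ne_zero h1).symm

theorem inner_momentum_eq {ħ : ℝ} (hħ : ħ ≠ 0) {ψ ψ' φ φ' : H} (h : (ψ, ψ') ∈ momentumGraph ħ)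
    (h' : (φ, φ') ∈ momentumGraph ħ) : inner ℂ ψ' φ = inner ℂ ψ φ' := by
  have hħ' : (ħ : ℂ) ≠ 0 := by exact_mod_cast hħ
  have h1 := inner_eq_of_hasDerivAt expP_zero ((mem_momentumGraph_iff hħ).mp h)
    ((mem_momentumGraph_iff hħ).mp h')
  rw [inner_smul_left, inner_smul_right, map_div₀, Complex.conj_I, Complex.conj_ofReal, neg_div,
    neg_mul, add_neg_eq_zero] at h1
  exact (mul_left_cancel₀ (div_ne_zero Complex.I_ne_zero hħ') h1).symm

theorem test_mem_positionGraph {g : ℝ → ℝ} (hg : Continuous g) (hs : HasCompactSupport g) :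
    ∃ φ, ((memLp_test hg hs).toLp _, φ) ∈ positionGraph := by
  have hg' : Continuous fun x => x * g x := continuous_id.mul hg
  have hs' : HasCompactSupport fun x => x * g x := hs.mul_left
  refine ⟨(memLp_test hg' hs').toLp _, ?_⟩
  change ∀ᵐ x : ℝ, (memLp_test hg' hs').toLp _ x = (x : ℂ) * (memLp_test hg hs).toLp _ x
  filter_upwards [(memLp_test hg hs).coeFn_toLp, (memLp_test hg' hs').coeFn_toLp] with x h1 h2
  rw [h1, h2]
  push_cast
  rfl

theorem test_mem_momentumGraph (ħ : ℝ) {g : ℝ → ℝ} (hg : ContDiff ℝ ∞ g)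
    (hs : HasCompactSupport g) :
    ∃ φ, ((memLp_test hg.continuous hs).toLp _, φ) ∈ momentumGraph ħ := by
  have hg' : Continuous (deriv g) := hg.continuous_deriv (by simp)
  refine ⟨(-(Complex.I * ħ)) • (memLp_test hg' hs.deriv).toLp _, ?_⟩
  intro k hk hks
  have h1 : ∫ x, k x • ((-(Complex.I * ħ)) • (memLp_test hg' hs.deriv).toLp _ : H) x
      = ((∫ x, k x * deriv g x : ℝ) : ℂ) * (-(Complex.I * ħ)) := by
    rw [← integral_complex_ofReal, ← integral_mul_const]
    apply integral_congr_ae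
    filter_upwards [(memLp_test hg' hs.deriv).coeFn_toLp,
      Lp.coeFn_smul (-(Complex.I * ħ)) ((memLp_test hg' hs.deriv).toLp _)] with x h2 h3
    rw [h3, Pi.smul_apply, h2, Complex.real_smul, smul_eq_mul]
    push_cast
    ring
  have h2 : ∫ x, deriv k x • ((memLp_test hg.continuous hs).toLp _ : H) x
      = ((∫ x, deriv k x * g x : ℝ) : ℂ) := by
    rw [← integral_complex_ofReal]
    apply integral_congr_ae
    filter_upwards [(memLp_test hg.continuous hs).coeFn_toLp] with x h2
    rw [h2, Complex.real_smul]
    push_cast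
    rfl
  have hk' : Continuous (deriv k) := hk.continuous_deriv (by simp)
  have h3 : ∫ x, k x * deriv g x = - ∫ x, deriv k x * g x :=
    integral_mul_deriv_eq_deriv_mul_of_integrable
      (fun x _ => (hk.differentiable (by simp) x).hasDerivAt)
      (fun x _ => (hg.differentiable (by simp) x).hasDerivAt)
      ((hk.continuous.mul hg').integrable_of_hasCompactSupport hks.mul_right)
      ((hk'.mul hg.continuous).integrable_of_hasCompactSupport hs.mul_left)
      ((hk.continuous.mul hg.continuous).integrable_of_hasCompactSupport hs.mul_left)
  simp only [h1, h2, h3]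
  push_cast
  ring

/-! ### Cores of generators of one-parameter isometry groups -/

section Core

variable {E : Type*} [NormedAddCommGroup E] [InnerProductSpace ℂ E]
  {U : ℝ → E →L[ℂ] E}

theorem hasDerivAt_orbit (hadd : ∀ s t, U (s + t) = U s * U t) {ψ φ : E}
    (h : HasDerivAt (fun t => U t ψ) φ 0) (t : ℝ) : HasDerivAt (fun t => U t ψ) (U t φ) t := by
  have h1 : HasDerivAt (fun s => U (s - t) ψ) φ t := by
    have := HasDerivAt.comp_sub_const t t (f := fun t => U t ψ) (f' := φ) (by simpa using h)
    exact this
  have h2 := ((U t).restrictScalars ℝ).hasFDerivAt.comp_hasDerivAt t h1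
  refine HasDerivAt.congr_deriv (f' := (U t).restrictScalars ℝ φ) ?_ rfl
  convert h2 using 1
  funext s
  have h3 := hadd t (s - t)
  rw [add_sub_cancel] at h3
  rw [h3]
  rfl

/-- Conservation of the norm forces `Re⟪ψ, φ⟫ = 0`, so `‖ψ - φ‖² = ‖ψ‖² + ‖φ‖²`. This is the
resolvent bound for the generator at `1`. -/
theorem norm_le_norm_sub_of_hasDerivAt (hnorm : ∀ t ψ, ‖U t ψ‖ = ‖ψ‖) (h0 : U 0 = 1) {ψ φ : E}
    (h : HasDerivAt (fun t => U t ψ) φ 0) : ‖ψ‖ ≤ ‖ψ - φ‖ := by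
  have h1 := HasDerivAt.inner ℂ h h
  simp only [inner_self_eq_norm_sq_to_K, hnorm, h0, one_apply_eq_self] at h1
  have h2 := h1.unique (hasDerivAt_const _ _)
  have h3 : RCLike.re (inner ℂ ψ φ) = 0 := by
    have h4 := congrArg RCLike.re h2
    rw [map_add, inner_re_symm φ ψ] at h4
    simp only [map_zero] at h4
    linarith
  have h5 := @norm_sub_sq ℂ _ _ _ _ ψ φ
  rw [h3] at h5
  refine abs_le_of_sq_le_sq' ?_ (norm_nonneg _) |>.2
  nlinarith [sq_nonneg ‖φ‖]

/-- The generator is closed: the orbit derivatives `U t (v n).2` converge uniformly in `t` because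
`U t` is isometric, so the limit may be exchanged with the derivative. -/
theorem hasDerivAt_of_mem_closure (hnorm : ∀ t ψ, ‖U t ψ‖ = ‖ψ‖) (h0 : U 0 = 1)
    (hadd : ∀ s t, U (s + t) = U s * U t) {S : Set (E × E)}
    (hS : ∀ w ∈ S, HasDerivAt (fun t => U t w.1) w.2 0) {w : E × E} (hw : w ∈ closure S) :
    HasDerivAt (fun t => U t w.1) w.2 0 := by
  obtain ⟨v, hv, hlim⟩ := mem_closure_iff_seq_limit.mp hw
  have hunif : TendstoUniformly (fun n t => U t (v n).2) (fun t => U t w.2) atTop := by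
    rw [Metric.tendstoUniformly_iff]
    intro ε hε
    have h2 : Tendsto (fun n => (v n).2) atTop (𝓝 w.2) := (continuous_snd.tendsto w).comp hlim
    filter_upwards [Metric.tendsto_nhds.mp h2 ε hε] with n hn t
    rw [dist_eq_norm, ← map_sub, hnorm, ← dist_eq_norm, dist_comm]
    exact hn
  have h := hasDerivAt_of_tendstoUniformly (g := fun t => U t w.1) hunif
    (Eventually.of_forall fun n t => hasDerivAt_orbit hadd (hS _ (hv n)) t)
    (fun t => ((U t).continuous.tendsto _).comp ((continuous_fst.tendsto w).comp hlim)) 0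
  simpa [h0] using h

/-- A solution of `k' = k` is `e^t k(0)`, which is unbounded as `t → ∞` unless it vanishes. -/
theorem eq_zero_of_hasDerivAt_self {k : ℝ → ℂ} {C : ℝ} (hk : ∀ t, HasDerivAt k (k t) t)
    (hC : ∀ t, ‖k t‖ ≤ C) : k 0 = 0 := by
  have h1 : ∀ t, HasDerivAt (fun t => Real.exp (-t) • k t) 0 t := by
    intro t
    have h2 := ((hasDerivAt_neg t).exp).smul (hk t)
    refine h2.congr_deriv ?_
    module
  have h2 : ∀ t, Real.exp (-t) • k t = k 0 := by
    intro t
    have h3 := is_const_of_deriv_eq_zero (fun u => (h1 u).differentiableAt)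
        (fun u => (h1 u).deriv) t 0
    simpa using h3
  have h3 : Tendsto (fun t : ℝ => Real.exp (-t) * C) atTop (𝓝 0) := by
    simpa using Real.tendsto_exp_neg_atTop_nhds_zero.mul_const C
  have h4 : ‖k 0‖ ≤ 0 := by
    refine ge_of_tendsto' h3 fun t => ?_
    rw [← h2 t, norm_smul, Real.norm_of_nonneg (Real.exp_pos _).le]
    gcongr
    exact hC t
  exact norm_le_zero_iff.mp h4

/-- A dense domain which is invariant under a one-parameter group of isometries, and on which the
generator exists, is a core for the generator. -/
theorem hasDerivAt_iff_mem_closure [CompleteSpace E] (hnorm : ∀ t ψ, ‖U t ψ‖ = ‖ψ‖) (h0 : U 0 = 1)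
    (hadd : ∀ s t, U (s + t) = U s * U t) (A : E →ₗ.[ℂ] E) (hdense : Dense (A.domain : Set E))
    (hA : ∀ x : A.domain, HasDerivAt (fun t => U t x) (A x) 0)
    (hinv : ∀ t, ∀ x ∈ A.domain, U t x ∈ A.domain) (ψ φ : E) :
    HasDerivAt (fun t => U t ψ) φ 0 ↔ (ψ, φ) ∈ A.graph.topologicalClosure := by
  constructor
  · intro h
    -- The range of `1 - A` is dense: if `ξ` is orthogonal to it, invariance of the domain makes
    -- `k(t) = ⟪U t x, ξ⟫` a bounded solution of `k' = k`, so `⟪x, ξ⟫ = 0` on a dense set.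
    set K : Submodule ℂ E := LinearMap.range (A.domain.subtype - A.toFun) with hK
    have hKtop : K.topologicalClosure = ⊤ := by
      rw [Submodule.topologicalClosure_eq_top_iff, Submodule.eq_bot_iff]
      intro ξ hξ
      refine hdense.eq_zero_of_inner_left (𝕜 := ℂ) fun x hxA => ?_
      lift x to A.domain using hxA
      have hx : ∀ y : A.domain, inner ℂ (y : E) ξ = inner ℂ (A y) ξ := by
        intro y
        have h1 := (Submodule.mem_orthogonal K ξ).mp hξ ((y : E) - A y) ⟨y, rfl⟩
        rwa [inner_sub_left, sub_eq_zero] at h1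
      have hcomm : ∀ t, U t (A x) = A ⟨U t x, hinv t x x.2⟩ := by
        intro t
        refine HasDerivAt.unique ?_ (hA ⟨U t x, hinv t x x.2⟩)
        have h1 := ((U t).restrictScalars ℝ).hasFDerivAt.comp_hasDerivAt 0 (hA x)
        refine HasDerivAt.congr_deriv (f' := (U t).restrictScalars ℝ (A x)) ?_ rfl
        convert h1 using 1
        funext s
        change (U s * U t) x = (U t * U s) x
        rw [← hadd, ← hadd, add_comm]
      have hk : ∀ t, HasDerivAt (fun t => inner ℂ (U t x) ξ) (inner ℂ (U t x) ξ) t := by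
        intro t
        have h1 := HasDerivAt.inner ℂ (hasDerivAt_orbit hadd (hA x) t) (hasDerivAt_const t ξ)
        refine h1.congr_deriv ?_
        rw [inner_zero_right, zero_add, hcomm, ← hx ⟨U t x, hinv t x x.2⟩]
      have h2 := eq_zero_of_hasDerivAt_self hk (C := ‖(x : E)‖ * ‖ξ‖) fun t => by
        rw [← hnorm t x]
        exact norm_inner_le_norm _ _
      rw [h0] at h2
      exact inner_eq_zero_symm.mp h2
    have hmem : ψ - φ ∈ closure (K : Set E) := by
      rw [← Submodule.topologicalClosure_coe, hKtop]
      trivial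
    -- Choose `y n` in the domain with `(1 - A) y n → ψ - φ`. The resolvent bound, applied to `y n -
    -- ψ`, gives `y n → ψ`, and therefore `A (y n) → φ`.
    obtain ⟨v, hv, hlim⟩ := mem_closure_iff_seq_limit.mp hmem
    choose y hy using hv
    have hy : ∀ n, (y n : E) - A (y n) = v n := hy
    have hlim0 : Tendsto (fun n => ((y n : E) - ψ) - (A (y n) - φ)) atTop (𝓝 0) := by
      have h1 := tendsto_sub_nhds_zero_iff.mpr hlim
      refine h1.congr fun n => ?_
      rw [← hy n]
      abel
    have h1 : Tendsto (fun n => (y n : E) - ψ) atTop (𝓝 0) := by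
      refine squeeze_zero_norm (fun n => ?_) (tendsto_zero_iff_norm_tendsto_zero.mp hlim0)
      refine norm_le_norm_sub_of_hasDerivAt hnorm h0 ?_
      simp only [map_sub]
      exact (hA (y n)).sub h
    have h2 : Tendsto (fun n => A (y n) - φ) atTop (𝓝 0) := by
      have h3 := h1.sub hlim0
      simpa using h3
    change (ψ, φ) ∈ closure (A.graph : Set (E × E))
    refine mem_closure_of_tendsto ((tendsto_sub_nhds_zero_iff.mp h1).prodMk_nhds
      (tendsto_sub_nhds_zero_iff.mp h2)) (Eventually.of_forall fun n => A.mem_graph (y n))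
  · intro h
    refine hasDerivAt_of_mem_closure (S := (A.graph : Set (E × E))) (w := (ψ, φ)) hnorm h0 hadd
      (fun w hw => ?_) h
    obtain ⟨x, hx1, hx2⟩ := (LinearPMap.mem_graph_iff A).mp hw
    rw [← hx1, ← hx2]
    exact hA x

end Core

/-! ### Annihilation and creation operators on `dom Q ∩ dom P` -/

theorem exists_of_mem_domain_annihilation {ħ r : ℝ} {ψ : H}
    (h : ψ ∈ (annihilation ħ r).domain) :
    ∃ α β, (ψ, α) ∈ positionGraph ∧ (ψ, β) ∈ momentumGraph ħ := by
  have h' : ψ ∈ Q.domain ∧ ψ ∈ (P ħ).domain := h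
  obtain ⟨α, hα⟩ := LinearPMap.mem_domain_iff.mp h'.1
  obtain ⟨β, hβ⟩ := LinearPMap.mem_domain_iff.mp h'.2
  rw [graph_Q] at hα
  rw [graph_P] at hβ
  exact ⟨α, β, hα, hβ⟩

theorem annihilation_of_mem {ħ : ℝ} (r : ℝ) {ψ α β : H} (hα : (ψ, α) ∈ positionGraph)
    (hβ : (ψ, β) ∈ momentumGraph ħ) :
    ∃ h : ψ ∈ (annihilation ħ r).domain, annihilation ħ r ⟨ψ, h⟩ =
      ((1 / (√2 * r) : ℝ) : ℂ) • (α + (Complex.I * ((r ^ 2 / ħ : ℝ) : ℂ)) • β) := by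
  rw [← graph_Q] at hα
  rw [← graph_P] at hβ
  obtain ⟨⟨x, hx⟩, hx1, hx2⟩ := (LinearPMap.mem_graph_iff _).mp hα
  obtain ⟨⟨y, hy⟩, hy1, hy2⟩ := (LinearPMap.mem_graph_iff _).mp hβ
  simp only at hx1 hx2 hy1 hy2
  subst hx1
  subst hy1
  refine ⟨⟨hx, hy⟩, ?_⟩
  rw [← hx2, ← hy2]
  rfl

theorem dense_domain_annihilation (ħ r : ℝ) :
    Dense ((annihilation ħ r).domain : Set H) := by
  rw [Submodule.dense_iff_topologicalClosure_eq_top, Submodule.topologicalClosure_eq_top_iff,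
    Submodule.eq_bot_iff]
  intro ξ hξ
  refine eq_zero_of_integral_test_eq_zero fun g hg hs => ?_
  rw [← inner_test hg.continuous hs]
  obtain ⟨α, hα⟩ := test_mem_positionGraph hg.continuous hs
  obtain ⟨β, hβ⟩ := test_mem_momentumGraph ħ hg hs
  exact (Submodule.mem_orthogonal _ ξ).mp hξ _ (annihilation_of_mem r hα hβ).1

/-- Symmetry of `Q` and `P` exhibits the formal adjoint. The inclusion `dom a ⊆ dom a†` is all that
is needed, as `za† - z̄a` lives on the intersection of the two domains. -/
theorem creation_of_mem {ħ : ℝ} (hħ : ħ ≠ 0) (r : ℝ) {ψ α β : H} (hα : (ψ, α) ∈ positionGraph)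
    (hβ : (ψ, β) ∈ momentumGraph ħ) :
    ∃ h : ψ ∈ (creation ħ r).domain, creation ħ r ⟨ψ, h⟩ =
      ((1 / (√2 * r) : ℝ) : ℂ) • (α - (Complex.I * ((r ^ 2 / ħ : ℝ) : ℂ)) • β) := by
  have key : ∀ x : (annihilation ħ r).domain,
      inner ℂ (((1 / (√2 * r) : ℝ) : ℂ) • (α - (Complex.I * ((r ^ 2 / ħ : ℝ) : ℂ)) • β)) (x : H)
        = inner ℂ ψ (annihilation ħ r x) := by
    rintro ⟨x, hx⟩
    obtain ⟨α', β', hα', hβ'⟩ := exists_of_mem_domain_annihilation hx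
    obtain ⟨_, h1⟩ := annihilation_of_mem r hα' hβ'
    rw [h1, inner_smul_left, inner_sub_left, inner_smul_left, inner_position_eq hα hα',
      inner_momentum_eq hħ hβ hβ', inner_smul_right, inner_add_right, inner_smul_right, map_mul,
      Complex.conj_ofReal, Complex.conj_ofReal, Complex.conj_I]
    ring
  exact ⟨LinearPMap.mem_adjoint_domain_of_exists ψ ⟨_, key⟩,
    LinearPMap.adjoint_apply_eq (dense_domain_annihilation ħ r) _ key⟩

/-! ### Displacement operators -/

theorem displacement_apply {ħ r : ℝ} (hħ : ħ ≠ 0) (hr : r ≠ 0) (z : ℂ) (ψ : H) :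
    displacement ħ r z ψ = Complex.exp (-(Complex.I * ((z.re * z.im : ℝ) : ℂ))) •
      expQ (√2 * z.im / r) (expP (-(√2 * r * z.re)) ψ) := by
  have h1 : √2 * ħ * z.im / r / ħ = √2 * z.im / r := by field_simp
  have h2 : √2 * ħ * z.im / r * -(√2 * r * z.re) / (2 * ħ) = -(z.re * z.im) := by
    field_simp
    rw [Real.sq_sqrt (by norm_num)]
    ring
  change Complex.exp (Complex.I * ((√2 * ħ * z.im / r * -(√2 * r * z.re) / (2 * ħ) : ℝ) : ℂ)) •
      expQ (√2 * ħ * z.im / r / ħ) (expP (-(√2 * r * z.re)) ψ) = _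
  rw [h1, h2]
  push_cast
  rw [mul_neg]

theorem displacement_displacement {ħ r : ℝ} (hħ : ħ ≠ 0) (hr : r ≠ 0) (w z : ℂ) (ψ : H) :
    displacement ħ r w (displacement ħ r z ψ) =
      Complex.exp (Complex.I * ((wedge z w : ℝ) : ℂ)) • displacement ħ r (z + w) ψ := by
  have h1 : √2 * (z.im + w.im) / r = √2 * w.im / r + √2 * z.im / r := by ring
  have h2 : -(√2 * r * (z.re + w.re)) = -(√2 * r * w.re) + -(√2 * r * z.re) := by ring
  -- Moving `expP` of `w` past `expQ` of `z` costs this phase; with `-z'z'' - w'w''` it sums to `z∧w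
  -- - (z'+w')(z''+w'')`.
  have h4 : √2 * z.im / r * -(√2 * r * w.re) = -(2 * z.im * w.re) := by
    field_simp
    rw [Real.sq_sqrt (by norm_num)]
    ring
  simp only [displacement_apply hħ hr, map_smul, expP_expQ, Complex.add_re, Complex.add_im]
  rw [h1, h2, h4, expQ_add, expP_add]
  simp only [smul_smul, ← Complex.exp_add]
  congr 2
  simp only [wedge]
  push_cast
  ring

theorem displacement_zero {ħ r : ℝ} (hħ : ħ ≠ 0) (hr : r ≠ 0) (ψ : H) :
    displacement ħ r 0 ψ = ψ := by
  rw [displacement_apply hħ hr]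
  simp [expQ_zero, expP_zero]

theorem norm_displacement {ħ r : ℝ} (hħ : ħ ≠ 0) (hr : r ≠ 0) (z : ℂ) (ψ : H) :
    ‖displacement ħ r z ψ‖ = ‖ψ‖ := by
  rw [displacement_apply hħ hr, norm_smul, LinearIsometry.norm_map, LinearIsometry.norm_map,
    ← mul_neg, mul_comm Complex.I, ← Complex.ofReal_neg, Complex.norm_exp_ofReal_mul_I, one_mul]

/-- Strong continuity of a family of isometries is automatically joint continuity. -/
theorem continuous_expQ_comp {X : Type*} [TopologicalSpace X] {s : X → ℝ} {u : X → H}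
    (hs : Continuous s) (hu : Continuous u) : Continuous fun x => expQ (s x) (u x) := by
  rw [continuous_iff_continuousAt]
  intro x
  rw [ContinuousAt, ← tendsto_sub_nhds_zero_iff]
  have h1 : Tendsto (fun y => u y - u x) (𝓝 x) (𝓝 0) :=
    tendsto_sub_nhds_zero_iff.mpr hu.continuousAt
  have h2 : Tendsto (fun y => expQ (s y) (u y - u x)) (𝓝 x) (𝓝 0) := by
    rw [tendsto_zero_iff_norm_tendsto_zero] at h1 ⊢
    simpa only [LinearIsometry.norm_map] using h1
  have h3 : Tendsto (fun y => expQ (s y) (u x) - expQ (s x) (u x)) (𝓝 x) (𝓝 0) :=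
    tendsto_sub_nhds_zero_iff.mpr ((continuous_expQ (u x)).comp hs).continuousAt
  have h4 := h2.add h3
  rw [add_zero] at h4
  refine h4.congr fun y => ?_
  rw [map_sub]
  abel

theorem continuous_displacement {ħ r : ℝ} (hħ : ħ ≠ 0) (hr : r ≠ 0) (ψ : H) :
    Continuous fun z => displacement ħ r z ψ := by
  simp only [displacement_apply hħ hr]
  have hs : Continuous fun z : ℂ => √2 * z.im / r := by fun_prop
  have hq : Continuous fun z : ℂ => -(√2 * r * z.re) := by fun_prop
  have h1 : Continuous fun z : ℂ => Complex.exp (-(Complex.I * ((z.re * z.im : ℝ) : ℂ))) := by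
    fun_prop
  exact h1.smul (continuous_expQ_comp hs ((continuous_expP ψ).comp hq))

theorem displacement_mem_domain {ħ r : ℝ} (hħ : ħ ≠ 0) (hr : r ≠ 0) (z : ℂ) {ψ : H}
    (h : ψ ∈ (annihilation ħ r).domain) :
    displacement ħ r z ψ ∈ (annihilation ħ r).domain := by
  obtain ⟨α, β, hα, hβ⟩ := exists_of_mem_domain_annihilation h
  rw [displacement_apply hħ hr]
  exact Submodule.smul_mem _ _ (annihilation_of_mem r
    (expQ_mem_positionGraph (expP_mem_positionGraph hα _) _)
    (expQ_mem_momentumGraph hħ (expP_mem_momentumGraph hβ _) _)).1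

/-! ### Differentiability of displacement operators -/

/-- The remainder splits as `(expQ s ψ - ψ - sα) + expQ s (expP q ψ - ψ - qχ) + q (expQ s χ - χ)`.
The middle term is small by isometry and the last by strong continuity alone, so `χ` need not lie in
`dom Q`. -/
theorem hasFDerivAt_expQ_expP {ψ α χ : H} (hα : HasDerivAt (fun s => expQ s ψ) α 0)
    (hχ : HasDerivAt (fun q => expP q ψ) χ 0) :
    HasFDerivAt (fun p : ℝ × ℝ => expQ p.1 (expP p.2 ψ))
      ((ContinuousLinearMap.fst ℝ ℝ ℝ).smulRight α + (ContinuousLinearMap.snd ℝ ℝ ℝ).smulRight χ)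
      0 := by
  have h1 := (HasFDerivAt.comp (0 : ℝ × ℝ) (f := Prod.fst) hα.hasFDerivAt
    hasFDerivAt_fst).isLittleO
  have h2 := (HasFDerivAt.comp (0 : ℝ × ℝ) (f := Prod.snd) hχ.hasFDerivAt
    hasFDerivAt_snd).isLittleO
  have h3 : (fun p : ℝ × ℝ => expQ p.1 (expP p.2 ψ - ψ - p.2 • χ)) =o[𝓝 0]
      fun p : ℝ × ℝ => p - 0 := by
    refine (Asymptotics.IsLittleO.of_norm_left ?_)
    simp only [LinearIsometry.norm_map]
    refine Asymptotics.IsLittleO.norm_left ?_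
    refine h2.congr_left fun p => ?_
    simp [expP_zero]
  have h4 : (fun p : ℝ × ℝ => p.2 • (expQ p.1 χ - χ)) =o[𝓝 0] fun p : ℝ × ℝ => p - 0 := by
    have h5 : (fun p : ℝ × ℝ => expQ p.1 χ - χ) =o[𝓝 0] fun _ => (1 : ℝ) := by
      rw [Asymptotics.isLittleO_one_iff]
      have h6 : Tendsto (fun p : ℝ × ℝ => expQ p.1 χ) (𝓝 0) (𝓝 (expQ 0 χ)) :=
        ((continuous_expQ χ).comp continuous_fst).tendsto 0
      rw [expQ_zero] at h6
      exact tendsto_sub_nhds_zero_iff.mpr h6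
    have h7 : (fun p : ℝ × ℝ => p.2) =O[𝓝 0] fun p : ℝ × ℝ => ‖p‖ := by
      refine Asymptotics.IsBigO.of_bound 1 (Eventually.of_forall fun p => ?_)
      rw [one_mul, norm_norm]
      exact norm_snd_le p
    have h8 := h7.smul_isLittleO h5
    simp only [smul_eq_mul, mul_one] at h8
    simpa using h8.of_norm_right
  refine HasFDerivAt.of_isLittleO (((h1.add h3).add h4).congr_left fun p => ?_)
  have h5 : expQ p.1 (p.2 • χ) = p.2 • expQ p.1 χ :=
    (expQ p.1).toLinearMap.map_smul_of_tower p.2 χ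
  simp [expP_zero, expQ_zero, smul_sub, h5]
  abel

theorem hasFDerivAt_displacement_zero {ħ r : ℝ} (hħ : ħ ≠ 0) (hr : r ≠ 0) {ψ α β : H}
    (hα : (ψ, α) ∈ positionGraph) (hβ : (ψ, β) ∈ momentumGraph ħ) :
    HasFDerivAt (fun z => displacement ħ r z ψ)
      (Complex.imCLM.smulRight ((√2 / r) • Complex.I • α)
        - Complex.reCLM.smulRight ((√2 * r) • (Complex.I / ħ) • β)) 0 := by
  simp only [displacement_apply hħ hr]
  have h1 := hasFDerivAt_expQ_expP (hasDerivAt_expQ_of_mem hα) ((mem_momentumGraph_iff hħ).mp hβ)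
  let T : ℂ →L[ℝ] ℝ × ℝ := ((√2 / r) • Complex.imCLM).prod ((-(√2 * r)) • Complex.reCLM)
  have hT : ∀ z : ℂ, T z = (√2 * z.im / r, -(√2 * r * z.re)) := by
    intro z
    simp [T]
    ring
  have h2 := HasFDerivAt.comp (0 : ℂ) (g := fun p : ℝ × ℝ => expQ p.1 (expP p.2 ψ)) (f := T)
    (by rw [map_zero]; exact h1) T.hasFDerivAt
  -- The phase is quadratic in `z`, hence does not contribute at `0`.
  have h3 : HasFDerivAt (fun z : ℂ => Complex.exp (-(Complex.I * ((z.re * z.im : ℝ) : ℂ))))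
      (0 : ℂ →L[ℝ] ℂ) 0 := by
    have h4 : HasFDerivAt (fun z : ℂ => z.re * z.im) (0 : ℂ →L[ℝ] ℝ) 0 := by
      have h5 := (Complex.reCLM.hasFDerivAt (x := (0 : ℂ))).mul Complex.imCLM.hasFDerivAt
      exact h5.congr_fderiv (by simp)
    have h6 := Complex.ofRealCLM.hasFDerivAt.comp (0 : ℂ) h4
    have h7 := ((h6.const_mul Complex.I).neg).cexp
    simpa using h7
  have h8 := h3.smul h2
  refine (h8.congr_fderiv ?_).congr_of_eventuallyEq (Eventually.of_forall fun z => ?_)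
  · refine ContinuousLinearMap.ext fun z => ?_
    simp [hT]
    module
  · simp only [Pi.smul_apply', Function.comp_apply, hT]

theorem hasFDerivAt_displacement {ħ r : ℝ} (hħ : ħ ≠ 0) (hr : r ≠ 0) (z : ℂ) {ψ : H}
    (hψ : ψ ∈ (annihilation ħ r).domain) :
    ∃ (L : ℂ →L[ℝ] H) (h : displacement ħ r z ψ ∈ (annihilation ħ r).domain)
      (h' : displacement ħ r z ψ ∈ (creation ħ r).domain),
      HasFDerivAt (fun w => displacement ħ r w ψ) L z ∧
      ∀ u, L u = u • creation ħ r ⟨_, h'⟩ - conj u • annihilation ħ r ⟨_, h⟩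
        - (Complex.I * ((wedge z u : ℝ) : ℂ)) • displacement ħ r z ψ := by
  obtain ⟨α, β, hα, hβ⟩ :=
    exists_of_mem_domain_annihilation (displacement_mem_domain hħ hr z hψ)
  obtain ⟨h, ha⟩ := annihilation_of_mem r hα hβ
  obtain ⟨h', ha'⟩ := creation_of_mem hħ r hα hβ
  have h1 := hasFDerivAt_displacement_zero hħ hr hα hβ
  let B : ℂ →L[ℝ] ℝ := z.re • Complex.imCLM - z.im • Complex.reCLM
  have hB : ∀ u, B u = wedge z u := fun u => by simp [B, wedge]
  have h2 : HasFDerivAt (fun u : ℂ => Complex.exp (-(Complex.I * ((wedge z u : ℝ) : ℂ))))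
      (-(Complex.I • Complex.ofRealCLM.comp B)) 0 := by
    have h3 := Complex.ofRealCLM.hasFDerivAt.comp (0 : ℂ) (B.hasFDerivAt (x := (0 : ℂ)))
    have h4 := ((h3.const_mul Complex.I).neg).cexp
    simpa [hB, wedge] using h4
  have h5 := h2.smul h1
  -- The composition law is solved for `D(z+u)` with `D(u)` on the left, so that the derivative at
  -- `0` acts on `D(z)ψ`.
  have h6 : HasFDerivAt (fun u => displacement ħ r (z + u) ψ) _ 0 :=
    h5.congr_of_eventuallyEq (Eventually.of_forall fun u => by
      simp only [Pi.smul_apply']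
      rw [displacement_displacement hħ hr, smul_smul, ← Complex.exp_add, neg_add_cancel,
        Complex.exp_zero, one_smul])
  have h7 := HasFDerivAt.comp z (g := fun u => displacement ħ r (z + u) ψ)
    (f := fun w => w - z) (by rw [sub_self]; exact h6) ((hasFDerivAt_id z).sub_const z)
  refine ⟨_, h, h', h7.congr_of_eventuallyEq (Eventually.of_forall fun w => by simp), fun u => ?_⟩
  rw [ha, ha']
  have hs : ((√2 : ℝ) : ℂ) * ((√2 : ℝ) : ℂ) = 2 := by
    exact_mod_cast Real.mul_self_sqrt (by norm_num : (0 : ℝ) ≤ 2)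
  have hs0 : ((√2 : ℝ) : ℂ) ≠ 0 := by
    intro h0
    rw [h0] at hs
    norm_num at hs
  have hr' : (r : ℂ) ≠ 0 := by exact_mod_cast hr
  have hħ' : (ħ : ℂ) ≠ 0 := by exact_mod_cast hħ
  have hw0 : wedge z 0 = 0 := by simp [wedge]
  have hu : u = u.re + u.im * Complex.I := (Complex.re_add_im u).symm
  have hu' : conj u = u.re - u.im * Complex.I := by
    apply Complex.ext <;> simp
  rw [hu']
  simp only [hB, hw0, displacement_zero hħ hr, ContinuousLinearMap.comp_id,
    add_apply, smul_apply, sub_apply,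
    ContinuousLinearMap.smulRight_apply, neg_apply,
    ContinuousLinearMap.comp_apply, Complex.imCLM_apply, Complex.reCLM_apply,
    Complex.ofRealCLM_apply, Complex.ofReal_zero, mul_zero, neg_zero, Complex.exp_zero, one_smul]
  generalize u.re = p at *
  generalize u.im = q at *
  subst hu
  push_cast
  match_scalars
  · simp only [Complex.coe_algebraMap]
    field_simp
    linear_combination (q * Complex.I) * hs
  · simp only [Complex.coe_algebraMap]
    field_simp
    linear_combination (-(p : ℂ)) * hs
  · ring

/-! ### The exponential formula and the differential equation -/

theorem isUnitaryExp_displacement {ħ r : ℝ} (hħ : ħ ≠ 0) (hr : r ≠ 0) (z : ℂ) :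
    IsUnitaryExp (z • creation ħ r - conj z • annihilation ħ r) (displacement ħ r z) := by
  set A : H →ₗ.[ℂ] H := z • creation ħ r - conj z • annihilation ħ r with hAdef
  have hdom : A.domain = (annihilation ħ r).domain := by
    refine inf_eq_right.mpr fun ψ hψ => ?_
    obtain ⟨α, β, hα, hβ⟩ := exists_of_mem_domain_annihilation hψ
    exact (creation_of_mem hħ r hα hβ).1
  have h0 : displacement ħ r (((0 : ℝ) : ℂ) * z) = 1 := by
    ext1 ψ
    simp [displacement_zero hħ hr]
  have hadd : ∀ s t : ℝ, displacement ħ r (((s + t : ℝ) : ℂ) * z) =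
      displacement ħ r ((s : ℂ) * z) * displacement ħ r ((t : ℂ) * z) := by
    intro s t
    ext1 ψ
    have hw : wedge ((t : ℂ) * z) ((s : ℂ) * z) = 0 := by
      simp [wedge]
      ring
    rw [mul_apply_eq_comp, displacement_displacement hħ hr, hw]
    simp [add_mul, add_comm]
  have hnorm : ∀ (t : ℝ) (ψ : H), ‖displacement ħ r ((t : ℂ) * z) ψ‖ = ‖ψ‖ := fun t ψ =>
    norm_displacement hħ hr _ ψ
  refine ⟨fun t => displacement ħ r ((t : ℂ) * z), fun t => ?_, h0, hadd, fun ψ => ?_,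
    hasDerivAt_iff_mem_closure hnorm h0 hadd A ?_ ?_ ?_, by simp⟩
  · have h1 : star (displacement ħ r ((t : ℂ) * z)) * displacement ħ r ((t : ℂ) * z) = 1 :=
      (ContinuousLinearMap.norm_map_iff_adjoint_comp_self _).mp (hnorm t)
    have h2 : displacement ħ r ((t : ℂ) * z) * displacement ħ r (((-t : ℝ) : ℂ) * z) = 1 := by
      rw [← hadd, add_neg_cancel, h0]
    refine Unitary.mem_iff.mpr ⟨h1, ?_⟩
    rw [left_inv_eq_right_inv h1 h2, h2]
  · exact (continuous_displacement hħ hr ψ).comp (by fun_prop)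
  · rw [hdom]
    exact dense_domain_annihilation ħ r
  · rintro ⟨ψ, hψ⟩
    obtain ⟨L, h, h', hL, hLu⟩ := hasFDerivAt_displacement hħ hr 0 hψ.2
    have h1 : HasDerivAt (fun t : ℝ => (t : ℂ) * z) z 0 := by
      simpa using (Complex.ofRealCLM.hasDerivAt (x := (0 : ℝ))).mul_const z
    have h2 := HasFDerivAt.comp_hasDerivAt (0 : ℝ) (f := fun t : ℝ => (t : ℂ) * z)
      (l := fun w => displacement ħ r w ψ) (by simpa using hL) h1
    refine h2.congr_deriv ?_
    rw [hLu]
    simp only [wedge, displacement_zero hħ hr, Complex.zero_re, Complex.zero_im, zero_mul, sub_zero,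
      Complex.ofReal_zero, mul_zero, zero_smul]
    rfl
  · intro t ψ hψ
    rw [hdom] at hψ ⊢
    exact displacement_mem_domain hħ hr _ hψ

theorem hasFDerivAt_displacement_comp {ħ r : ℝ} (hħ : ħ ≠ 0) (hr : r ≠ 0) {f : Minkowski → ℂ}
    {f' : Minkowski →L[ℝ] ℂ} {x : Minkowski} (hf : HasFDerivAt f f' x) {ζ : H}
    (hζ : ζ ∈ (annihilation ħ r).domain) :
    ∃ L : Minkowski →L[ℝ] H, HasFDerivAt (fun y => displacement ħ r (f y) ζ) L x ∧
      ∀ μ : Fin 4, ∃ h : displacement ħ r (f x) ζ ∈ (X ħ r f μ x).domain,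
        (Complex.I * (ħ : ℂ)) • L (EuclideanSpace.single μ (1 : ℝ)) =
          X ħ r f μ x ⟨displacement ħ r (f x) ζ, h⟩ := by
  obtain ⟨L, h, h', hL, hLu⟩ := hasFDerivAt_displacement hħ hr (f x) hζ
  refine ⟨L.comp f', hL.comp x hf, fun μ => ⟨⟨⟨trivial, h'⟩, h⟩, ?_⟩⟩
  have h1 : partialD μ f x = f' (EuclideanSpace.single μ (1 : ℝ)) :=
    (hf.hasLineDerivAt _).lineDeriv
  have h2 : partialD μ (fun y => conj (f y)) x = conj (f' (EuclideanSpace.single μ (1 : ℝ))) := by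
    have h3 := Complex.conjCLE.toContinuousLinearMap.hasFDerivAt.comp x hf
    exact (h3.hasLineDerivAt _).lineDeriv
  change _ = (ħ : ℂ) • (((wedge (f x) (partialD μ f x) : ℝ) : ℂ) • displacement ħ r (f x) ζ
    + (Complex.I * partialD μ f x) • creation ħ r ⟨_, h'⟩
    - (Complex.I * partialD μ (fun y => conj (f y)) x) • annihilation ħ r ⟨_, h⟩)
  rw [h1, h2, ContinuousLinearMap.comp_apply, hLu]
  simp only [smul_sub, smul_add, smul_smul]
  -- The factor `iħ` turns the phase term `-i f∧∂_μ f` into `+ħ f∧∂_μ f`.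
  have h4 : Complex.I * ħ * (Complex.I * ((wedge (f x) (f' (EuclideanSpace.single μ (1 : ℝ))) : ℝ)
      : ℂ)) = -(ħ * ((wedge (f x) (f' (EuclideanSpace.single μ (1 : ℝ))) : ℝ) : ℂ)) := by
    linear_combination (ħ * ((wedge (f x) (f' (EuclideanSpace.single μ (1 : ℝ))) : ℝ) : ℂ))
      * Complex.I_mul_I
  rw [h4]
  module

end Oscillator

theorem mainTheorem1 (ħ r : ℝ) (hħ : 0 < ħ) (hr : 0 < r) :
    (∀ z : ℂ, Oscillator.IsUnitaryExp
      (z • Oscillator.creation ħ r - conj z • Oscillator.annihilation ħ r)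
      (Oscillator.displacement ħ r z)) ∧
    ∀ f : Oscillator.Minkowski → ℂ, Differentiable ℝ f →
      ∀ ζ ∈ Oscillator.numberDomain ħ r,
        Differentiable ℝ (fun x => Oscillator.displacement ħ r (f x) ζ) ∧
        ∀ (x : Oscillator.Minkowski) (μ : Fin 4),
          ∃ h : Oscillator.displacement ħ r (f x) ζ ∈ (Oscillator.X ħ r f μ x).domain,
            (Complex.I * (ħ : ℂ)) •
                Oscillator.partialD μ (fun y => Oscillator.displacement ħ r (f y) ζ) x =
              Oscillator.X ħ r f μ x ⟨Oscillator.displacement ħ r (f x) ζ, h⟩ := by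
  refine ⟨Oscillator.isUnitaryExp_displacement hħ.ne' hr.ne', ?_⟩
  rintro f hf ζ ⟨hζ, -⟩
  have key := fun x =>
    Oscillator.hasFDerivAt_displacement_comp hħ.ne' hr.ne' (hf x).hasFDerivAt hζ
  refine ⟨fun x => ?_, fun x μ => ?_⟩
  · obtain ⟨L, hL, -⟩ := key x
    exact hL.differentiableAt
  · obtain ⟨L, hL, hX⟩ := key x
    rw [Oscillator.partialD, (hL.hasLineDerivAt _).lineDeriv]
    exact hX μ
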